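/- **Theorem.** Let $G=(V,E)$ be a connected, locally finite graph on which simple random walk is transient. Let $P_x$ be the law of the simple random walk $(X_n)_{n\ge 0}$ started at $x\in V$, let $d(y)$ be the degree of $y$, and let $$g(x,y)=\frac1{d(y)}\sum_{n\ge0}P_x[X_n=y]$$ be its Green function. Let $\varphi=(\varphi_x)_{x\in V}$ be the Gaussian free field on $G$, i.e. a centered Gaussian process with covariance $\mathbb E[\varphi_x\varphi_y]=g(x,y)$. For finite $K\subset V$ let $$\mathrm{cap}(K)=\sum_{x\in K}d(x)\,P_x[X_n\notin K\text{ for all }n\ge1],$$ and for finite $S\subset V$ let $\overline S$ be the union of $S$ with the set of all vertices adjacent to $S$. For finite $X\subset V$ and $h\in\mathbb R$ let $\mathcal C_X(h)$ be the union of all connected components of the subgraph of $G$ induced on $\{x\in V:\varphi_x\ge h\}$ that intersect $X$. Let $F$ be a complex-valued function on the finite subsets of $V$ of subexponential growth, meaning that 1. $|F(S)|\le e^{o(\mathrm{cap}(\overline S))}$ as $\mathrm{cap}(\overline S)\to\infty$, i.e. for every $\varepsilon>0$ there is $R$ such that $|F(S)|\le e^{\varepsilon\,\mathrm{cap}(\overline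 S)}$ for all finite $S$ with $\mathrm{cap}(\overline S)\ge R$; and 2. for every finite $Y\subset V$ and every $R\in\mathbb R$, $F$ is bounded on the family of finite sets $S$ with $\mathrm{cap}(\overline S)\le R$ such that every connected component of (the subgraph induced on) $S$ intersects $Y$. Then for every finite $X\subset V$ the function $$\overline F^X(h)=\mathbb E\big[F(\mathcal C_X(h))\,\mathbf 1_{|\mathcal C_X(h)|<\infty}\big]$$ is well defined for every $h\in(-\infty,0)$, i.e. the random variable inside the expectation is integrable, and $\overline F^X$ is real-analytic on $(-\infty,0)$. -/

import Mathlib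

open MeasureTheory ProbabilityTheory

noncomputable section

namespace GFFPercolation

section Walk

variable {V : Type*} [MeasurableSpace V] [DiscreteMeasurableSpace V]

/-- Law of one step of simple random walk from `x`: uniform on the neighbours of `x`
(an isolated vertex, which does not occur in a transient graph, is absorbing). -/
def stepPMF (G : SimpleGraph V) [G.LocallyFinite] (x : V) : PMF V :=
  open Classical in
  if h : (G.neighborFinset x).Nonempty then PMF.uniformOfFinset (G.neighborFinset x) h
  else PMF.pure x

/-- The transition kernel at time `n`, a function of the path up to time `n`. -/
def stepKernel (G : SimpleGraph V) [G.LocallyFinite] (n : ℕ) :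
    Kernel ((i : Finset.Iic n) → (fun _ : ℕ => V) i) V where
  toFun path := (stepPMF G (path ⟨n, Finset.mem_Iic.2 le_rfl⟩)).toMeasure
  measurable' := Measurable.comp (g := fun x : V => (stepPMF G x).toMeasure)
    Measurable.of_discrete (measurable_pi_apply _)

instance (G : SimpleGraph V) [G.LocallyFinite] (n : ℕ) : IsMarkovKernel (stepKernel G n) :=
  ⟨fun p => PMF.toMeasure.isProbabilityMeasure _⟩

/-- The canonical law `P_x` of discrete-time simple random walk on `G` started at `x`. -/
def walk (G : SimpleGraph V) [G.LocallyFinite] (x : V) : Measure (ℕ → V) :=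
  Kernel.traj (X := fun _ : ℕ => V) (stepKernel G) 0 (fun _ => x)

/-- `P_x[the walk is outside K at all times n ≥ 1]`. -/
def escapeProb (G : SimpleGraph V) [G.LocallyFinite] (K : Set V) (x : V) : ℝ :=
  (walk G x).real {ω | ∀ n, 1 ≤ n → ω n ∉ K}

/-- `G` is transient: from every vertex, simple random walk has positive probability of
never returning. -/
def IsTransient (G : SimpleGraph V) [G.LocallyFinite] : Prop :=
  ∀ x : V, 0 < escapeProb G {x} x

/-- The Green function `g(x, y) = d(y)⁻¹ ∑ₙ P_x[Xₙ = y]`. -/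
def green (G : SimpleGraph V) [G.LocallyFinite] (x y : V) : ℝ :=
  (∑' n : ℕ, (walk G x).real {ω | ω n = y}) / (G.degree y : ℝ)

/-- The harmonic capacity of a finite set `K`: total mass of the equilibrium measure
`e_K(x) = d(x) P_x[H̃_K = ∞] 1_{x ∈ K}`. -/
def cap (G : SimpleGraph V) [G.LocallyFinite] (K : Finset V) : ℝ :=
  ∑ x ∈ K, (G.degree x : ℝ) * escapeProb G (K : Set V) x

/-- The vertex closure of a finite set: the set together with its outer boundary. -/
def vertexClosure [DecidableEq V] (G : SimpleGraph V) [G.LocallyFinite] (S : Finset V) :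
    Finset V :=
  S ∪ S.biUnion (fun x => G.neighborFinset x)

end Walk

/-- The union of all connected components, in the subgraph of `G` induced on `A`,
that intersect `X`. -/
def cluster {V : Type*} (G : SimpleGraph V) (A X : Set V) : Set V :=
  {y | ∃ x ∈ X, ∃ (hx : x ∈ A) (hy : y ∈ A), (G.induce A).Reachable ⟨x, hx⟩ ⟨y, hy⟩}

/-- A cluster observable `F` has subexponential growth: `|F(S)| ≤ e^{o(cap(S̄))}` as
`cap(S̄) → ∞`, and (so that the bound also says something about the possibly infinitely many
clusters of bounded capacity) for each finite `X`, `F` is bounded on families of bounded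
capacity among the finite sets `S` that can occur as a union of clusters
meeting `X`, that is, all of whose connected components intersect `X`. -/
structure SubexponentialGrowth {V : Type*} [MeasurableSpace V] [DiscreteMeasurableSpace V]
    [DecidableEq V] (G : SimpleGraph V) [G.LocallyFinite] (F : Finset V → ℂ) : Prop where
  growth : ∀ ε : ℝ, 0 < ε → ∃ R : ℝ, ∀ S : Finset V, R ≤ cap G (vertexClosure G S) →
    ‖F S‖ ≤ Real.exp (ε * cap G (vertexClosure G S))
  locally_bounded : ∀ (X : Finset V) (R : ℝ), ∃ C : ℝ, ∀ S : Finset V,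
    cluster G (S : Set V) (X : Set V) = (S : Set V) → cap G (vertexClosure G S) ≤ R → ‖F S‖ ≤ C

/-- `φ` is a Gaussian free field on `G` under `P`: a centered Gaussian process whose
covariance is the Green function. -/
structure IsGFF {V : Type*} [MeasurableSpace V] [DiscreteMeasurableSpace V]
    (G : SimpleGraph V) [G.LocallyFinite]
    {Ω : Type*} [MeasurableSpace Ω] (P : Measure Ω) (φ : V → Ω → ℝ) : Prop where
  gaussian : IsGaussianProcess φ P
  centered : ∀ x, ∫ ω, φ x ω ∂P = 0
  covariance : ∀ x y, ∫ ω, φ x ω * φ y ω ∂P = green G x y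

/-- `𝒞_X(h)`: the union of all clusters of `{φ ≥ h}` that intersect `X`. -/
def levelCluster {V : Type*} (G : SimpleGraph V) {Ω : Type*} (φ : V → Ω → ℝ)
    (X : Finset V) (h : ℝ) (ω : Ω) : Set V :=
  cluster G {x | h ≤ φ x ω} (X : Set V)

/-- The random variable `F(𝒞_X(h)) 1_{|𝒞_X(h)| < ∞}`. -/
def truncatedObservable {V : Type*} (G : SimpleGraph V) {Ω : Type*} (φ : V → Ω → ℝ)
    (F : Finset V → ℂ) (X : Finset V) (h : ℝ) (ω : Ω) : ℂ :=
  open Classical in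
  if hfin : (levelCluster G φ X h ω).Finite then F hfin.toFinset else 0

/-- `F̄^X(h) = E[F(𝒞_X(h)) 1_{|𝒞_X(h)| < ∞}]`. -/
def meanObservable {V : Type*} (G : SimpleGraph V) {Ω : Type*} [MeasurableSpace Ω]
    (P : Measure Ω) (φ : V → Ω → ℝ) (F : Finset V → ℂ) (X : Finset V) (h : ℝ) : ℂ :=
  ∫ ω, truncatedObservable G φ F X h ω ∂P

end GFFPercolation

end

/-! Split according to the value S of 𝒞_X(h), and put K = S̄ ∪ X (`clusterHull`). Whether a possible
S is the cluster depends only on the signs of φ - h on K: nonnegative on S, negative on K \ S. The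
equilibrium measure e_K has Green potential 1 on K, so by Cameron–Martin shifting φ on K by the
constant -h is an exponential tilt (`IsGFF.real_signEvent`): P[𝒞_X(h) = S] = exp(-h² cap(K) / 2) ·
E[exp(-h M); 𝒞_X(0) = S], M = ∑ e_K(x) φ_x. All neighbours of S lie in K, so e_K vanishes on S and M
≤ 0 on the event on the right (`equilibriumField_nonpos`). Hence the right side extends
holomorphically to Re z < 0, with modulus at most exp(-Re(z²) cap(K) / 2) · P[𝒞_X(0) = S]
(`IsGFF.norm_clusterProb_le`).

Where moreover Re z² > 2δ, a factor exp(-δ cap(K)) is available to absorb |F(S)|. What remains is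
summable merely because the events at level 0 are disjoint; no decay of their probabilities is
needed. By the Weierstrass test over the countably many finite S, the sum is holomorphic near every
h < 0, and on the negative real axis it is the mean observable. -/

open MeasureTheory ProbabilityTheory

namespace GFFPercolation

/-! ### Markov property and escape probabilities of the walk -/

section Walk

open scoped ENNReal

variable {V : Type*} [MeasurableSpace V] [DiscreteMeasurableSpace V]
  (G : SimpleGraph V) [G.LocallyFinite]

/-- Probability that the walk from `x` avoids `K` at times `1, …, m`. -/
noncomputable def avoidProb (K : Set V) : ℕ → V → ℝ≥0∞
  | 0, _ => 1
  | m + 1, x => ∫⁻ y, Kᶜ.indicator (avoidProb K m) y ∂(stepPMF G x).toMeasure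

/-- Law of the walk after time `n`, given its path up to time `n`. -/
noncomputable abbrev trajFrom (n : ℕ) :
    Kernel ((i : Finset.Iic n) → (fun _ : ℕ => V) i) (ℕ → V) :=
  Kernel.traj (X := fun _ : ℕ => V) (stepKernel G) n

lemma measurableSet_avoid (K : Set V) (n m : ℕ) :
    MeasurableSet {ω : ℕ → V | ∀ j, 1 ≤ j → j ≤ m → ω (n + j) ∉ K} := by
  have : {ω : ℕ → V | ∀ j, 1 ≤ j → j ≤ m → ω (n + j) ∉ K} =
      ⋂ j, ⋂ (_ : 1 ≤ j), ⋂ (_ : j ≤ m), (fun ω : ℕ → V => ω (n + j)) ⁻¹' Kᶜ := by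
    ext; simp
  rw [this]
  exact .iInter fun j => .iInter fun _ => .iInter fun _ =>
    measurable_pi_apply _ (MeasurableSet.of_discrete)

lemma measurableSet_escape (K : Set V) (n : ℕ) :
    MeasurableSet {ω : ℕ → V | ∀ j, 1 ≤ j → ω (n + j) ∉ K} := by
  have : {ω : ℕ → V | ∀ j, 1 ≤ j → ω (n + j) ∉ K} =
      ⋂ j, ⋂ (_ : 1 ≤ j), (fun ω : ℕ → V => ω (n + j)) ⁻¹' Kᶜ := by
    ext; simp
  rw [this]
  exact .iInter fun j => .iInter fun _ =>
    measurable_pi_apply _ (MeasurableSet.of_discrete)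

lemma measurableSet_eval (A : Set V) (n : ℕ) : MeasurableSet {ω : ℕ → V | ω n ∈ A} :=
  measurable_pi_apply n (MeasurableSet.of_discrete (s := A))

lemma ae_trajFrom_eval (n : ℕ) (p : (i : Finset.Iic n) → (fun _ : ℕ => V) i) :
    ∀ᵐ ω ∂trajFrom G n p, ω n = p ⟨n, Finset.mem_Iic.2 le_rfl⟩ := by
  have h := congrArg (fun κ => κ p)
    (Kernel.traj_map_frestrictLe_of_le (X := fun _ : ℕ => V) (κ := stepKernel G) (le_refl n))
  simp only [Kernel.map_apply _ (Preorder.measurable_frestrictLe n),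
    Kernel.deterministic_apply] at h
  set A : Set ((i : Finset.Iic n) → (fun _ : ℕ => V) i) :=
    {q | q ⟨n, Finset.mem_Iic.2 le_rfl⟩ ∈ ({p ⟨n, Finset.mem_Iic.2 le_rfl⟩}ᶜ : Set V)}
  have hA : MeasurableSet A :=
    measurable_pi_apply (X := fun _ : Finset.Iic n => V) ⟨n, Finset.mem_Iic.2 le_rfl⟩
      (MeasurableSet.of_discrete)
  have h2 := congrArg (fun μ => μ A) h
  simp only [Measure.dirac_apply' _ hA] at h2
  have h3 := Measure.map_apply (μ := trajFrom G n p)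
    (f := Preorder.frestrictLe (π := fun _ : ℕ => V) n) (by fun_prop) hA
  rw [ae_iff]
  refine Eq.trans ?_ (h3.symm.trans (h2.trans ?_))
  · rfl
  · rw [Set.indicator_of_notMem]
    simp [A]

lemma trajFrom_apply_eq_lintegral {a b : ℕ} (hab : a ≤ b)
    (p : (i : Finset.Iic a) → (fun _ : ℕ => V) i) {A : Set (ℕ → V)} (hA : MeasurableSet A) :
    trajFrom G a p A = ∫⁻ q, trajFrom G b q A
      ∂(Kernel.partialTraj (X := fun _ : ℕ => V) (stepKernel G) a b p) := by
  rw [trajFrom, ← Kernel.traj_comp_partialTraj hab, Kernel.comp_apply' _ _ _ hA]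

/-- Condition on one more step and induct on `m`. The starting time `n` and the past `p` must vary,
since the inductive hypothesis is used at time `n + 1`. -/
lemma trajFrom_avoid (K : Set V) (m n : ℕ) (p : (i : Finset.Iic n) → (fun _ : ℕ => V) i) :
    trajFrom G n p {ω | ∀ j, 1 ≤ j → j ≤ m → ω (n + j) ∉ K} =
      avoidProb G K m (p ⟨n, Finset.mem_Iic.2 le_rfl⟩) := by
  induction m generalizing n p with
  | zero =>
    have : {ω : ℕ → V | ∀ j, 1 ≤ j → j ≤ 0 → ω (n + j) ∉ K} = Set.univ := by
      ext; simp; omega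
    rw [this, measure_univ]; rfl
  | succ m ih =>
    rw [trajFrom_apply_eq_lintegral G (Nat.le_succ n) p (measurableSet_avoid K n (m + 1))]
    have key : ∀ q : (i : Finset.Iic (n + 1)) → (fun _ : ℕ => V) i,
        trajFrom G (n + 1) q {ω | ∀ j, 1 ≤ j → j ≤ m + 1 → ω (n + j) ∉ K} =
        Kᶜ.indicator (avoidProb G K m) (q ⟨n + 1, Finset.mem_Iic.2 le_rfl⟩) := by
      intro q
      have hae := ae_trajFrom_eval G (n + 1) q
      by_cases hq : q ⟨n + 1, Finset.mem_Iic.2 le_rfl⟩ ∈ K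
      · rw [Set.indicator_of_notMem (by simpa using hq)]
        rw [measure_eq_zero_iff_ae_notMem]
        filter_upwards [hae] with ω hω h
        exact h 1 le_rfl (by omega) (hω ▸ hq)
      · rw [Set.indicator_of_mem (by simpa using hq), ← ih (n + 1) q]
        apply measure_congr
        filter_upwards [hae] with ω hω
        apply propext
        constructor
        · intro h j h1 h2
          have := h (1 + j) (by omega) (by omega)
          rwa [← add_assoc] at this
        · intro h j h1 h2
          obtain rfl | h3 := Nat.eq_or_lt_of_le h1
          · rw [hω]; exact hq
          · have := h (j - 1) (by omega) (by omega)
            rwa [show n + 1 + (j - 1) = n + j by omega] at this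
    simp_rw [Nat.succ_eq_add_one, key]
    have h1 := Kernel.map_partialTraj_succ_self (X := fun _ : ℕ => V) (κ := stepKernel G) n
    have h2 := congrArg (fun κ => κ p) h1
    have hm : Measurable fun x : (i : Finset.Iic (n + 1)) → (fun _ : ℕ => V) i =>
      x ⟨n + 1, Finset.mem_Iic.2 le_rfl⟩ :=
        measurable_pi_apply (X := fun _ : Finset.Iic (n + 1) => V) _
    simp only [Kernel.map_apply _ hm] at h2
    rw [← lintegral_map (f := Kᶜ.indicator (avoidProb G K m)) Measurable.of_discrete hm, h2]
    rfl

lemma trajFrom_escape (K : Set V) (n : ℕ) (p : (i : Finset.Iic n) → (fun _ : ℕ => V) i) :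
    trajFrom G n p {ω | ∀ j, 1 ≤ j → ω (n + j) ∉ K} =
      ⨅ m, avoidProb G K m (p ⟨n, Finset.mem_Iic.2 le_rfl⟩) := by
  have h : {ω : ℕ → V | ∀ j, 1 ≤ j → ω (n + j) ∉ K} =
      ⋂ m, {ω | ∀ j, 1 ≤ j → j ≤ m → ω (n + j) ∉ K} := by
    ext ω; simp only [Set.mem_ofPred_eq, Set.mem_iInter]
    exact ⟨fun h m j h1 _ => h j h1, fun h j h1 => h j j h1 le_rfl⟩
  rw [h, Antitone.measure_iInter]
  · simp_rw [trajFrom_avoid]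
  · intro a b hab ω hω j h1 h2
    exact hω j h1 (h2.trans hab)
  · exact fun m => (measurableSet_avoid K n m).nullMeasurableSet
  · exact ⟨0, measure_ne_top _ _⟩

instance (x : V) : IsProbabilityMeasure (walk G x) := by
  unfold walk; infer_instance

lemma walk_escape (K : Set V) (x : V) :
    walk G x {ω | ∀ j, 1 ≤ j → ω j ∉ K} = ⨅ m, avoidProb G K m x := by
  have := trajFrom_escape G K 0 (fun _ => x)
  simp only [zero_add] at this
  exact this

lemma walk_avoid_le (K : Set V) (x : V) (m : ℕ) :
    walk G x {ω | ∀ j, 1 ≤ j → ω j ∉ K} ≤ avoidProb G K m x := by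
  rw [walk_escape]; exact iInf_le _ m

/-- Markov property at time `n` for the event of avoiding `K` afterwards. -/
lemma walk_eval_escape (K : Set V) (x y : V) (n : ℕ) :
    walk G x {ω | ω n = y ∧ ∀ j, 1 ≤ j → ω (n + j) ∉ K} =
      walk G x {ω | ω n = y} * walk G y {ω | ∀ j, 1 ≤ j → ω j ∉ K} := by
  have hA : MeasurableSet {ω : ℕ → V | ω n = y ∧ ∀ j, 1 ≤ j → ω (n + j) ∉ K} :=
    (measurableSet_eval {y} n).inter (measurableSet_escape K n)
  have hB : MeasurableSet {ω : ℕ → V | ω n = y} := measurableSet_eval {y} n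
  have e1 := trajFrom_apply_eq_lintegral G (Nat.zero_le n) (fun _ => x) hA
  have e2 := trajFrom_apply_eq_lintegral G (Nat.zero_le n) (fun _ => x) hB
  rw [walk, e1, e2, ← lintegral_mul_const]
  · congr 1
    ext q
    -- Given the path `q` up to time `n`, the event `ω n = y` is decided, so it factors out of the
    -- integrand.
    have hae := ae_trajFrom_eval G n q
    by_cases hq : q ⟨n, Finset.mem_Iic.2 le_rfl⟩ = y
    · have h1 : trajFrom G n q {ω | ω n = y} = 1 := by
        rw [show (1 : ℝ≥0∞) = trajFrom G n q Set.univ from measure_univ.symm]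
        apply measure_congr
        filter_upwards [hae] with ω hω
        exact propext ⟨fun _ => trivial, fun _ => hω.trans hq⟩
      rw [h1, one_mul, walk_escape, ← hq, ← trajFrom_escape]
      apply measure_congr
      filter_upwards [hae] with ω hω
      apply propext
      exact ⟨fun h => h.2, fun h => ⟨hω, h⟩⟩
    · have h1 : trajFrom G n q {ω | ω n = y} = 0 := by
        rw [measure_eq_zero_iff_ae_notMem]
        filter_upwards [hae] with ω hω h
        exact hq (hω.symm.trans h)
      rw [h1, zero_mul]
      exact measure_mono_null (fun ω h => h.1) h1
  · exact Kernel.measurable_coe _ hB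

lemma escapeProb_nonneg (K : Set V) (x : V) : 0 ≤ escapeProb G K x := measureReal_nonneg

/-- Already the first step lands in `K`. The hypothesis `x ∈ K` covers an isolated `x`, where the
walk stays put. -/
lemma escapeProb_eq_zero {K : Set V} {x : V} (h : ∀ y, G.Adj x y → y ∈ K) (hx : x ∈ K) :
    escapeProb G K x = 0 := by
  rw [escapeProb, Measure.real, ENNReal.toReal_eq_zero_iff]
  left
  rw [← nonpos_iff_eq_zero]
  refine (walk_avoid_le G K x 1).trans (le_of_eq ?_)
  have hf : avoidProb G K 0 = fun _ => 1 := rfl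
  rw [avoidProb, hf, lintegral_indicator_const MeasurableSet.of_discrete, one_mul,
    PMF.toMeasure_apply_eq_zero_iff _ MeasurableSet.of_discrete, Set.disjoint_compl_right_iff_subset]
  unfold stepPMF
  split_ifs with hne
  · intro y hy
    rw [PMF.mem_support_uniformOfFinset_iff, SimpleGraph.mem_neighborFinset] at hy
    exact h y hy
  · simpa using hx

variable {G}

lemma IsTransient.degree_pos (ht : IsTransient G) (x : V) : 0 < (G.degree x : ℝ) := by
  rw [Nat.cast_pos, Nat.pos_iff_ne_zero]
  intro h0
  refine (ht x).ne' (escapeProb_eq_zero G (fun y hy => ?_) rfl)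
  rw [SimpleGraph.degree, Finset.card_eq_zero] at h0
  rw [← SimpleGraph.mem_neighborFinset, h0] at hy
  simp at hy

end Walk

/-! ### Last exits, equilibrium measure and capacity -/

section Potential

open scoped ENNReal

variable {V : Type*} [MeasurableSpace V] [DiscreteMeasurableSpace V]
  {G : SimpleGraph V} [G.LocallyFinite]

/-- The event that `n` is the last time at which the path is in `K`. -/
def lastVisit (K : Set V) (n : ℕ) : Set (ℕ → V) :=
  {ω | ω n ∈ K ∧ ∀ j, 1 ≤ j → ω (n + j) ∉ K}

lemma measurableSet_lastVisit (K : Set V) (n : ℕ) : MeasurableSet (lastVisit K n) :=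
  (measurableSet_eval K n).inter (measurableSet_escape K n)

omit [MeasurableSpace V] [DiscreteMeasurableSpace V] in
lemma pairwise_disjoint_lastVisit (K : Set V) :
    Pairwise (Function.onFun Disjoint (lastVisit K)) := by
  intro m n hmn
  rw [Function.onFun, Set.disjoint_left]
  rintro ω ⟨h1, h2⟩ ⟨h3, h4⟩
  obtain h | h := lt_or_gt_of_ne hmn
  · exact h2 (n - m) (by omega) (by rwa [Nat.add_sub_cancel' h.le])
  · exact h4 (m - n) (by omega) (by rwa [Nat.add_sub_cancel' h.le])

variable (G) in
/-- Last exit decomposition. -/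
lemma sum_tsum_walk_mul_escape (K : Finset V) (x : V) :
    ∑ y ∈ K, (∑' n, walk G x {ω | ω n = y}) * walk G y {ω | ∀ j, 1 ≤ j → ω j ∉ (K : Set V)} =
      walk G x (⋃ n, lastVisit (K : Set V) n) := by
  rw [measure_iUnion (pairwise_disjoint_lastVisit _) (measurableSet_lastVisit _)]
  have h : ∀ n, walk G x (lastVisit (K : Set V) n) = ∑ y ∈ K,
      walk G x {ω | ω n = y} * walk G y {ω | ∀ j, 1 ≤ j → ω j ∉ (K : Set V)} := by
    intro n
    simp_rw [← walk_eval_escape]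
    rw [← measure_biUnion_finset]
    · congr 1
      ext ω
      simp [lastVisit]
    · intro y _ z _ hyz
      rw [Function.onFun, Set.disjoint_left]
      rintro ω ⟨h1, -⟩ ⟨h2, -⟩
      exact hyz (h1.symm.trans h2)
    · exact fun y _ => (measurableSet_eval {y} n).inter (measurableSet_escape (K : Set V) n)
  simp_rw [h]
  rw [Summable.tsum_finsetSum (fun _ _ => ENNReal.summable)]
  simp_rw [ENNReal.tsum_mul_right]

/-- Last exit from `{y}`: the expected number of visits times a positive escape probability is
itself a probability. -/
lemma IsTransient.tsum_walk_ne_top (ht : IsTransient G) (x y : V) :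
    ∑' n, walk G x {ω | ω n = y} ≠ ∞ := by
  have h := sum_tsum_walk_mul_escape G {y} x
  rw [Finset.sum_singleton, Finset.coe_singleton] at h
  intro htop
  have hpos : walk G y {ω | ∀ j, 1 ≤ j → ω j ∉ ({y} : Set V)} ≠ 0 := by
    intro h0
    have := ht y
    rw [escapeProb, Measure.real, h0] at this
    simp at this
  rw [htop, ENNReal.top_mul hpos] at h
  exact measure_ne_top _ _ h.symm

lemma green_eq_toReal (x y : V) :
    green G x y = (∑' n, walk G x {ω | ω n = y}).toReal / G.degree y := by
  rw [green, ENNReal.tsum_toReal_eq fun _ => measure_ne_top _ _]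
  rfl

lemma walk_ae_zero (x : V) : ∀ᵐ ω ∂walk G x, ω 0 = x := ae_trajFrom_eval G 0 (fun _ => x)

/-- By Borel–Cantelli each point of the finite set `K` is visited finitely often; starting in `K`
guarantees at least one visit, hence a last one. -/
lemma IsTransient.ae_mem_lastVisit (ht : IsTransient G) (K : Finset V) {x : V} (hx : x ∈ K) :
    ∀ᵐ ω ∂walk G x, ω ∈ ⋃ n, lastVisit (K : Set V) n := by
  have h1 : ∀ᵐ ω ∂walk G x, ∀ y ∈ K, ∀ᶠ n in Filter.atTop, ω n ≠ y := by
    refine (ae_ball_iff (p := fun (ω : ℕ → V) y _ => ∀ᶠ n in Filter.atTop, ω n ≠ y)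
      K.countable_toSet).2 fun y _ => ?_
    have := measure_setOfPred_frequently_eq_zero (ht.tsum_walk_ne_top x y)
    rw [ae_iff]
    convert this using 2
    ext ω
    simp [Filter.frequently_atTop]
  filter_upwards [h1, walk_ae_zero x] with ω h1 h0
  have h2 : ∀ᶠ n in Filter.atTop, ω n ∉ K := by
    have := (Finset.eventually_all K).2 h1
    filter_upwards [this] with n hn hmem
    exact hn _ hmem rfl
  obtain ⟨N, hN⟩ := Filter.eventually_atTop.1 h2
  classical
  set n := Nat.findGreatest (fun n => ω n ∈ K) N
  have hn : ω n ∈ K :=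
    Nat.findGreatest_spec (P := fun n => ω n ∈ K) (Nat.zero_le N) (h0 ▸ hx)
  refine Set.mem_iUnion.2 ⟨n, hn, fun j hj hmem => ?_⟩
  by_cases hle : n + j ≤ N
  · exact Nat.findGreatest_is_greatest (P := fun n => ω n ∈ K) (by omega : n < n + j) hle hmem
  · exact hN (n + j) (by omega) hmem

/-- The equilibrium measure of `K`. -/
noncomputable def eqMeasure (G : SimpleGraph V) [G.LocallyFinite] (K : Finset V) (x : V) : ℝ :=
  (G.degree x : ℝ) * escapeProb G (K : Set V) x

lemma eqMeasure_nonneg (K : Finset V) (x : V) : 0 ≤ eqMeasure G K x :=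
  mul_nonneg (Nat.cast_nonneg _) (escapeProb_nonneg G _ _)

lemma cap_eq_sum (K : Finset V) : cap G K = ∑ x ∈ K, eqMeasure G K x := rfl

lemma cap_nonneg (K : Finset V) : 0 ≤ cap G K :=
  Finset.sum_nonneg fun x _ => eqMeasure_nonneg K x

/-- The degree in the equilibrium measure cancels the one in the Green function, leaving the last
exit decomposition. -/
lemma IsTransient.sum_green_mul_eqMeasure (ht : IsTransient G) (K : Finset V) (x : V) :
    ∑ y ∈ K, green G x y * eqMeasure G K y = (walk G x).real (⋃ n, lastVisit (K : Set V) n) := by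
  rw [Measure.real, ← sum_tsum_walk_mul_escape, ENNReal.toReal_sum]
  · refine Finset.sum_congr rfl fun y _ => ?_
    rw [ENNReal.toReal_mul, green_eq_toReal, eqMeasure, escapeProb, Measure.real]
    have := (ht.degree_pos y).ne'
    field_simp
  · exact fun y _ => ENNReal.mul_ne_top (ht.tsum_walk_ne_top x y) (measure_ne_top _ _)

lemma IsTransient.sum_green_mul_eqMeasure_le_one (ht : IsTransient G) (K : Finset V) (x : V) :
    ∑ y ∈ K, green G x y * eqMeasure G K y ≤ 1 := by
  rw [ht.sum_green_mul_eqMeasure]; exact measureReal_le_one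

lemma IsTransient.sum_green_mul_eqMeasure_eq_one (ht : IsTransient G) (K : Finset V) {x : V}
    (hx : x ∈ K) : ∑ y ∈ K, green G x y * eqMeasure G K y = 1 := by
  rw [ht.sum_green_mul_eqMeasure, Measure.real]
  have : walk G x (⋃ n, lastVisit (K : Set V) n) = walk G x Set.univ :=
    measure_congr <| by
      filter_upwards [ht.ae_mem_lastVisit K hx] with ω hω
      exact propext ⟨fun _ => trivial, fun _ => hω⟩
  rw [this, measure_univ, ENNReal.toReal_one]

/-- Pair e_K with e_L through the Green function: the potential of e_L is 1 on `K`, that of e_K is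
at most 1 everywhere. Symmetry of the Green function is assumed here because a free field supplies
it for free, as a covariance. -/
lemma IsTransient.cap_mono (ht : IsTransient G) (hsymm : ∀ x y, green G x y = green G y x)
    {K L : Finset V} (hKL : K ⊆ L) : cap G K ≤ cap G L := by
  calc cap G K = ∑ x ∈ K, eqMeasure G K x * ∑ y ∈ L, green G x y * eqMeasure G L y := by
        rw [cap_eq_sum]
        refine Finset.sum_congr rfl fun x hx => ?_
        rw [ht.sum_green_mul_eqMeasure_eq_one L (hKL hx), mul_one]
    _ = ∑ y ∈ L, eqMeasure G L y * ∑ x ∈ K, green G y x * eqMeasure G K x := by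
        simp_rw [Finset.mul_sum]
        rw [Finset.sum_comm]
        refine Finset.sum_congr rfl fun y _ => Finset.sum_congr rfl fun x _ => ?_
        rw [hsymm x y]; ring
    _ ≤ ∑ y ∈ L, eqMeasure G L y := by
        refine Finset.sum_le_sum fun y _ => ?_
        exact mul_le_of_le_one_right (eqMeasure_nonneg L y)
          (ht.sum_green_mul_eqMeasure_le_one K y)
    _ = cap G L := rfl

end Potential

/-! ### Clusters as local events; countability of the graph -/

section Clusters

variable {V : Type*} {G : SimpleGraph V}

lemma cluster_subset (A X : Set V) : cluster G A X ⊆ A := fun _ ⟨_, _, _, hy, _⟩ => hy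

lemma cluster_mono {A B : Set V} (hAB : A ⊆ B) (X : Set V) :
    cluster G A X ⊆ cluster G B X := by
  rintro y ⟨x, hxX, hx, hy, h⟩
  exact ⟨x, hxX, hAB hx, hAB hy, h.map (SimpleGraph.induceHomOfLE G hAB).toHom⟩

lemma inter_subset_cluster (A X : Set V) : A ∩ X ⊆ cluster G A X :=
  fun x hx => ⟨x, hx.2, hx.1, hx.1, .refl _⟩

lemma mem_cluster_of_adj {A X : Set V} {x y : V} (hx : x ∈ cluster G A X) (hy : y ∈ A)
    (h : G.Adj x y) : y ∈ cluster G A X := by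
  obtain ⟨z, hzX, hz, hxA, hr⟩ := hx
  exact ⟨z, hzX, hz, hy, hr.trans (SimpleGraph.Adj.reachable (by simpa using h))⟩

/-- A walk in `A` started in a set `S` closed under adjacency in `A` stays in `S`. -/
lemma reachable_induce_of_closed {A S : Set V}
    (hS : ∀ x ∈ S, ∀ y ∈ A, G.Adj x y → y ∈ S) {x y : A} (h : (G.induce A).Reachable x y)
    (hx : x.1 ∈ S) : ∃ hy : y.1 ∈ S, (G.induce S).Reachable ⟨x, hx⟩ ⟨y, hy⟩ := by
  obtain ⟨w⟩ := h
  induction w with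
  | nil => exact ⟨hx, .refl _⟩
  | @cons u v w huv p ih =>
    have huv' : G.Adj u.1 v.1 := by simpa using huv
    have hv := hS _ hx _ v.2 huv'
    obtain ⟨hy, hr⟩ := ih hv
    exact ⟨hy, (SimpleGraph.Adj.reachable (by simpa using huv')).trans hr⟩

/-- For fixed `S` the first condition does not involve `A`; the others concern `A` only on `S`, its
outer boundary and `X`. This is what makes the event that the cluster is a given finite set
finite-dimensional. -/
lemma cluster_eq_iff (A X S : Set V) :
    cluster G A X = S ↔ cluster G S X = S ∧ S ⊆ A ∧
      (∀ x ∈ X, x ∉ S → x ∉ A) ∧ ∀ x ∈ S, ∀ y, G.Adj x y → y ∉ S → y ∉ A := by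
  constructor
  · rintro rfl
    have hcl : ∀ x ∈ cluster G A X, ∀ y ∈ A, G.Adj x y → y ∈ cluster G A X :=
      fun x hx y hy h => mem_cluster_of_adj hx hy h
    refine ⟨(cluster_subset _ _).antisymm ?_, cluster_subset _ _, ?_, ?_⟩
    · rintro y ⟨x, hxX, hx, hy, h⟩
      have hxc := inter_subset_cluster (G := G) A X ⟨hx, hxX⟩
      obtain ⟨hy', hr⟩ := reachable_induce_of_closed hcl h hxc
      exact ⟨x, hxX, hxc, hy', hr⟩
    · exact fun x hxX hx hxA => hx (inter_subset_cluster A X ⟨hxA, hxX⟩)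
    · exact fun x hx y h hy hyA => hy (hcl x hx y hyA h)
  · rintro ⟨hc, hSA, hX, hb⟩
    refine Set.Subset.antisymm ?_ (hc.symm.subset.trans (cluster_mono hSA X))
    rintro y ⟨x, hxX, hx, hy, h⟩
    have hxS : x ∈ S := by_contra fun hn => hX x hxX hn hx
    exact (reachable_induce_of_closed
      (fun a ha b hb' hab => by_contra fun hn => hb a ha b hab hn hb') h hxS).1

/-- A connected locally finite graph is countable. -/
lemma countable_of_connected [G.LocallyFinite] (h : G.Connected) : Countable V := by
  obtain ⟨v⟩ := h.nonempty
  let B : ℕ → Set V := fun n => {w | ∃ p : G.Walk w v, p.length = n}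
  have hB : ∀ n, (B n).Countable := by
    intro n
    induction n with
    | zero =>
      refine (Set.countable_singleton v).mono ?_
      rintro w ⟨p, hp⟩
      exact SimpleGraph.Walk.eq_of_length_eq_zero hp
    | succ n ih =>
      refine (ih.biUnion fun u _ => (G.neighborFinset u).countable_toSet).mono ?_
      rintro w ⟨p, hp⟩
      cases p with
      | nil => simp at hp
      | @cons _ u _ huw q =>
        simp only [SimpleGraph.Walk.length_cons, Nat.add_right_cancel_iff] at hp
        exact Set.mem_iUnion₂.2 ⟨u, ⟨q, hp⟩, by simpa using huw.symm⟩
  have : (Set.univ : Set V).Countable :=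
    (Set.countable_iUnion hB).mono fun w _ =>
      by
      obtain ⟨p⟩ := h.preconnected w v
      exact Set.mem_iUnion.2 ⟨p.length, p, rfl⟩
  exact Set.countable_univ_iff.1 this

end Clusters

/-! ### Cameron–Martin formula in finite dimension, with possibly degenerate covariance -/

section CameronMartin

variable {ι : Type*} [Fintype ι] {μ : Measure (ι → ℝ)}

lemma exists_coeff_of_strongDual_pi (L : StrongDual ℝ (ι → ℝ)) :
    ∃ a : ι → ℝ, (L : (ι → ℝ) → ℝ) = fun x => ∑ i, a i * x i := by
  refine ⟨fun i => L (Pi.basisFun ℝ ι i), funext fun x => ?_⟩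
  conv_lhs => rw [← (Pi.basisFun ℝ ι).sum_repr x]
  simp [mul_comm]

/-- A linear functional as a continuous functional. -/
noncomputable def dotFunctional (c : ι → ℝ) : StrongDual ℝ (ι → ℝ) :=
  ∑ j, c j • ContinuousLinearMap.proj j

@[simp]
lemma dotFunctional_apply (c x : ι → ℝ) : dotFunctional c x = ∑ j, c j * x j := by
  simp [dotFunctional]

lemma integral_dual_eq_zero [IsGaussian μ] (h0 : ∀ i, ∫ x, x i ∂μ = 0)
    (L : StrongDual ℝ (ι → ℝ)) : ∫ x, L x ∂μ = 0 := by
  obtain ⟨a, ha⟩ := exists_coeff_of_strongDual_pi L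
  rw [ha, integral_finsetSum]
  · simp [integral_const_mul, h0]
  · intro i _
    have := (IsGaussian.integrable_dual μ (ContinuousLinearMap.proj i : StrongDual ℝ (ι → ℝ)))
    exact this.const_mul _

lemma mgf_dual [IsGaussian μ] (h0 : ∀ i, ∫ x, x i ∂μ = 0)
    (L : StrongDual ℝ (ι → ℝ)) (s : ℝ) : mgf L μ s = Real.exp (Var[L; μ] * s ^ 2 / 2) := by
  have h := IsGaussian.map_eq_gaussianReal (μ := μ) L
  rw [mgf_gaussianReal h, integral_dual_eq_zero h0 L, Real.coe_toNNReal _ (variance_nonneg _ _)]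
  simp

lemma integrable_exp_dual [IsGaussian μ] (h0 : ∀ i, ∫ x, x i ∂μ = 0)
    (L : StrongDual ℝ (ι → ℝ)) : Integrable (fun x => Real.exp (L x)) μ := by
  by_contra hn
  have h := mgf_dual h0 L 1
  -- A non-integrable exponential would have `mgf` equal to the default value 0, against the
  -- positive Gaussian formula.
  rw [mgf_undef (by simpa using hn)] at h
  exact (Real.exp_pos _).ne h

lemma memLp_dual [IsGaussian μ] (L : StrongDual ℝ (ι → ℝ)) : MemLp L 2 μ :=
  IsGaussian.memLp_dual μ L 2 (by norm_num)

lemma covariance_dual [IsGaussian μ] {c v : ι → ℝ}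
    (hcov : ∀ i, ∑ j, cov[fun x => x i, fun x => x j; μ] * c j = v i)
    (L : StrongDual ℝ (ι → ℝ)) : cov[L, dotFunctional c; μ] = L v := by
  have hp : ∀ i, MemLp (fun x : ι → ℝ => x i) 2 μ := fun i =>
    memLp_dual (ContinuousLinearMap.proj i : StrongDual ℝ (ι → ℝ))
  obtain ⟨a, h1⟩ := exists_coeff_of_strongDual_pi L
  have h2 : (dotFunctional c : (ι → ℝ) → ℝ) = fun x => ∑ j, c j * x j :=
    funext (dotFunctional_apply c)
  rw [h1, h2,
    covariance_fun_sum_fun_sum (fun i => (hp i).const_mul _) (fun j => (hp j).const_mul _)]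
  refine Finset.sum_congr rfl fun i _ => ?_
  rw [← hcov i, Finset.mul_sum]
  refine Finset.sum_congr rfl fun j _ => ?_
  rw [covariance_const_mul_left, covariance_const_mul_right]
  ring

/-- Cameron–Martin formula for a centered Gaussian measure on a finite-dimensional space. -/
lemma map_add_eq_tilted [IsGaussian μ] (h0 : ∀ i, ∫ x, x i ∂μ = 0) {c v : ι → ℝ}
    (hcov : ∀ i, ∑ j, cov[fun x => x i, fun x => x j; μ] * c j = v i) :
    μ.map (fun x => x + v) = μ.tilted (dotFunctional c) := by
  have hint : Integrable (fun x => Real.exp (dotFunctional c x)) μ :=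
    integrable_exp_dual h0 _
  have := isProbabilityMeasure_tilted hint
  have := Measure.isProbabilityMeasure_map (μ := μ) (f := fun x => x + v) (by fun_prop)
  have hL : ∀ L : StrongDual ℝ (ι → ℝ),
      (μ.map (fun x => x + v)).map L = (μ.tilted (dotFunctional c)).map L := by
    intro L
    have e1 : ∀ s, mgf L (μ.map (fun x => x + v)) s =
        Real.exp (Var[L; μ] * s ^ 2 / 2 + s * L v) := by
      intro s
      rw [mgf, integral_map (by fun_prop) (by fun_prop)]
      simp_rw [map_add, mul_add, Real.exp_add]
      rw [integral_mul_const]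
      congr 1
      exact mgf_dual h0 L s
    have e2 : ∀ s, mgf L (μ.tilted (dotFunctional c)) s =
        Real.exp (Var[L; μ] * s ^ 2 / 2 + s * L v) := by
      -- The tilted moment generating function is the quotient of those of `s • L + dotFunctional c`
      -- and `dotFunctional c`; the cross term of the variance gives the shift `s * L v`.
      intro s
      have hcL := covariance_dual hcov L
      have h1 := mgf_dual h0 (s • L + dotFunctional c) 1
      have h2 := mgf_dual h0 (dotFunctional c) 1
      have hv : Var[(s • L + dotFunctional c : StrongDual ℝ (ι → ℝ)); μ] =
          s ^ 2 * Var[L; μ] + 2 * (s * L v) + Var[dotFunctional c; μ] := by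
        have : ((s • L + dotFunctional c : StrongDual ℝ (ι → ℝ)) : (ι → ℝ) → ℝ) =
          (s • (L : (ι → ℝ) → ℝ)) + (dotFunctional c : (ι → ℝ) → ℝ) := by ext; simp
        rw [this, variance_add ((memLp_dual L).const_smul s) (memLp_dual _), variance_smul,
          covariance_smul_left, hcL]
      rw [hv] at h1
      simp only [mgf, one_mul] at h1 h2
      have h3 : ∀ x, (Real.exp (dotFunctional c x) / ∫ x, Real.exp (dotFunctional c x) ∂μ) •
          Real.exp (s * L x) =
          Real.exp ((s • L + dotFunctional c : StrongDual ℝ (ι → ℝ)) x) *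
            (∫ x, Real.exp (dotFunctional c x) ∂μ)⁻¹ := by
        intro x
        rw [smul_eq_mul, add_apply, Real.exp_add]
        simp only [smul_apply, smul_eq_mul]
        ring
      rw [mgf, integral_tilted]
      simp_rw [h3]
      rw [integral_mul_const, h1, h2, ← Real.exp_neg, ← Real.exp_add]
      congr 1
      ring
    have hset' : integrableExpSet L (μ.map (fun x => x + v)) = Set.univ := by
      ext s
      simp only [Set.mem_univ, iff_true]
      by_contra hn
      have := e1 s
      rw [mgf_undef hn] at this
      exact (Real.exp_pos _).ne this
    refine Measure.ext_of_complexMGF_eq (by fun_prop) (by fun_prop) (funext fun z => ?_)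
    -- Equal real moment generating functions, finite on all of ℝ, have equal analytic
    -- continuations, and these determine the law.
    have hz := eqOn_complexMGF_of_mgf (μ := μ.map (fun x => x + v)) (X := L)
      (μ' := μ.tilted (dotFunctional c)) (Y := L) (funext fun s => by rw [e1, e2])
    exact hz (by simp [hset'])
  -- Cramér–Wold: the laws of all linear functionals determine the measure.
  refine Measure.ext_of_charFunDual ?_
  ext L
  rw [charFunDual_eq_charFun_map_one, charFunDual_eq_charFun_map_one, hL]

end CameronMartin

/-- The normalising constant of the tilt is exp(Var / 2), and the variance of the functional `c` is
`∑ j, c j * v j`. -/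
lemma real_preimage_add_eq_setIntegral {ι : Type*} [Fintype ι] {μ : Measure (ι → ℝ)} [IsGaussian μ]
    (h0 : ∀ i, ∫ x, x i ∂μ = 0) {c v : ι → ℝ}
    (hcov : ∀ i, ∑ j, cov[fun x => x i, fun x => x j; μ] * c j = v i)
    {A : Set (ι → ℝ)} (hA : MeasurableSet A) :
    μ.real ((fun x => x + v) ⁻¹' A) =
      Real.exp (-(∑ j, c j * v j) / 2) * ∫ x in A, Real.exp (∑ j, c j * x j) ∂μ := by
  have hZ := mgf_dual h0 (dotFunctional c) 1
  rw [← covariance_self (by fun_prop), covariance_dual hcov, dotFunctional_apply] at hZ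
  simp only [mgf, one_mul, one_pow, mul_one] at hZ
  have h := congrArg (fun ν : Measure (ι → ℝ) => ν.real A) (map_add_eq_tilted h0 hcov)
  rw [map_measureReal_apply (by fun_prop) hA] at h
  rw [h, Measure.real, tilted_apply_eq_ofReal_integral' _ hA, hZ, integral_div,
    ENNReal.toReal_ofReal (div_nonneg (integral_nonneg fun _ => (Real.exp_pos _).le)
      (Real.exp_pos _).le), neg_div, Real.exp_neg]
  simp only [dotFunctional_apply]
  ring

/-! ### Changing the level of the free field -/

section Field

variable {V : Type*} [MeasurableSpace V] [DiscreteMeasurableSpace V]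
  {G : SimpleGraph V} [G.LocallyFinite]
  {Ω : Type*} [MeasurableSpace Ω] {P : Measure Ω} {φ : V → Ω → ℝ}

/-- The field `φ` is at least `h` on `K ∩ S` and less than `h` on `K \ S`. -/
def signEvent (φ : V → Ω → ℝ) (K S : Finset V) (h : ℝ) : Set Ω :=
  {ω | ∀ x ∈ K, (x ∈ S → h ≤ φ x ω) ∧ (x ∉ S → φ x ω < h)}

/-- The integral of the field against the equilibrium measure of `K`. -/
noncomputable def equilibriumField (G : SimpleGraph V) [G.LocallyFinite] (φ : V → Ω → ℝ)
    (K : Finset V) (ω : Ω) : ℝ :=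
  ∑ x ∈ K, eqMeasure G K x * φ x ω

lemma IsGFF.green_symm (hφ : IsGFF G P φ) (x y : V) : green G x y = green G y x := by
  rw [← hφ.covariance, ← hφ.covariance]
  simp_rw [mul_comm]

lemma IsGFF.aemeasurable (hφ : IsGFF G P φ) (x : V) : AEMeasurable (φ x) P :=
  hφ.gaussian.aemeasurable x

lemma IsGFF.aemeasurable_equilibriumField (hφ : IsGFF G P φ) (K : Finset V) :
    AEMeasurable (equilibriumField G φ K) P :=
  Finset.aemeasurable_fun_sum _ fun x _ => (hφ.aemeasurable x).const_mul _

/-- The set of configurations on `K` that are nonnegative exactly on `S`. -/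
def signSet (K S : Finset V) : Set (K → ℝ) :=
  {x | ∀ i, (i.1 ∈ S → 0 ≤ x i) ∧ (i.1 ∉ S → x i < 0)}

omit [MeasurableSpace V] [DiscreteMeasurableSpace V] in
lemma measurableSet_signSet (K S : Finset V) : MeasurableSet (signSet K S) := by
  have : signSet K S = ⋂ i, {x : K → ℝ | (i.1 ∈ S → 0 ≤ x i) ∧ (i.1 ∉ S → x i < 0)} := by
    ext; simp [signSet]
  rw [this]
  refine .iInter fun i => ?_
  by_cases hi : i.1 ∈ S
  · simp only [hi, true_imp_iff, not_true, false_imp_iff, and_true]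
    exact measurableSet_le measurable_const (measurable_pi_apply i)
  · simp only [hi, true_imp_iff, not_false_iff, false_imp_iff, true_and]
    exact measurableSet_lt (measurable_pi_apply i) measurable_const

omit [MeasurableSpace V] [DiscreteMeasurableSpace V] [MeasurableSpace Ω] in
lemma signEvent_eq_preimage (K S : Finset V) (h : ℝ) :
    signEvent φ K S h =
      (fun ω => K.restrict (φ · ω)) ⁻¹' ((fun x => x + fun _ => -h) ⁻¹' signSet K S) := by
  ext ω
  simp [signEvent, signSet, Finset.restrict]

omit [MeasurableSpace V] [DiscreteMeasurableSpace V] [MeasurableSpace Ω] in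
lemma signEvent_zero_eq_preimage (K S : Finset V) :
    signEvent φ K S 0 = (fun ω => K.restrict (φ · ω)) ⁻¹' signSet K S := by
  ext ω
  simp [signEvent, signSet, Finset.restrict]

lemma IsGFF.aemeasurable_restrict (hφ : IsGFF G P φ) (K : Finset V) :
    AEMeasurable (fun ω => K.restrict (φ · ω)) P :=
  aemeasurable_pi_lambda _ fun i => hφ.aemeasurable i

lemma IsGFF.nullMeasurableSet_signEvent (hφ : IsGFF G P φ) (K S : Finset V) (h : ℝ) :
    NullMeasurableSet (signEvent φ K S h) P := by
  rw [signEvent_eq_preimage]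
  exact (hφ.aemeasurable_restrict K).nullMeasurableSet_preimage
    ((measurableSet_signSet K S).preimage (by fun_prop))

/-- Change of level for the event that the field exceeds the level on `K` exactly at `S`. -/
lemma IsGFF.real_signEvent (hφ : IsGFF G P φ) (ht : IsTransient G) (K S : Finset V) (h : ℝ) :
    P.real (signEvent φ K S h) = Real.exp (-(h ^ 2 * cap G K) / 2) *
      ∫ ω in signEvent φ K S 0, Real.exp (-h * equilibriumField G φ K ω) ∂P := by
  have hm := hφ.aemeasurable_restrict K
  have hA := measurableSet_signSet K S
  set Y : Ω → K → ℝ := fun ω => K.restrict (φ · ω)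
  have : IsGaussian (P.map Y) := (hφ.gaussian.hasGaussianLaw K).isGaussian_map
  have : IsProbabilityMeasure P := hφ.gaussian.isProbabilityMeasure
  have h0 : ∀ i, ∫ x, x i ∂(P.map Y) = 0 := fun i => by
    rw [integral_map hm (measurable_pi_apply i).aestronglyMeasurable]
    exact hφ.centered i
  -- The tilt `-h * eqMeasure G K` produces the constant shift `-h`, because the equilibrium
  -- potential is 1 on `K`.
  have hcov : ∀ i : K, ∑ j : K, cov[fun x => x i, fun x => x j; P.map Y] *
      (-h * eqMeasure G K j) = -h := by
    intro i
    have h1 : ∀ j : K, cov[fun x => x i, fun x => x j; P.map Y] = green G i j := by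
      intro j
      rw [covariance_map_fun (measurable_pi_apply i).aestronglyMeasurable
        (measurable_pi_apply j).aestronglyMeasurable hm, covariance_eq_sub]
      · simp only [Y, Finset.restrict, hφ.centered, zero_mul, sub_zero]
        exact hφ.covariance i j
      · exact (hφ.gaussian.hasGaussianLaw_eval i).memLp_two
      · exact (hφ.gaussian.hasGaussianLaw_eval j).memLp_two
    simp_rw [h1, mul_left_comm _ (-h)]
    rw [← Finset.mul_sum, Finset.sum_coe_sort K (fun j => green G i j * eqMeasure G K j),
      ht.sum_green_mul_eqMeasure_eq_one K i.2, mul_one]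
  have hmain := real_preimage_add_eq_setIntegral h0 hcov hA
  have hpre : MeasurableSet ((fun x : K → ℝ => x + fun _ => -h) ⁻¹' signSet K S) :=
    hA.preimage (by fun_prop)
  rw [Measure.real, Measure.map_apply_of_aemeasurable hm hpre, ← signEvent_eq_preimage,
    ← Measure.real, setIntegral_map hA
      (Continuous.aestronglyMeasurable (by fun_prop)) hm, ← signEvent_zero_eq_preimage] at hmain
  have e1 : ∀ ω, ∑ j : K, -h * eqMeasure G K j * Y ω j = -h * equilibriumField G φ K ω := by
    intro ω
    rw [equilibriumField, Finset.mul_sum, ← Finset.sum_coe_sort K]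
    exact Finset.sum_congr rfl fun j _ => mul_assoc _ _ _
  have e2 : ∑ j : K, -h * eqMeasure G K j * -h = h ^ 2 * cap G K := by
    rw [cap_eq_sum, Finset.mul_sum, ← Finset.sum_coe_sort K]
    exact Finset.sum_congr rfl fun j _ => by ring
  rw [hmain, e2]
  simp_rw [e1]

end Field

/-! ### Sign of the equilibrium field on a cluster event -/

section Clusters

variable {V : Type*} [DecidableEq V] [MeasurableSpace V] [DiscreteMeasurableSpace V]
  {G : SimpleGraph V} [G.LocallyFinite]
  {Ω : Type*} {φ : V → Ω → ℝ}

/-- The vertices whose field values decide whether the cluster of `X` is `S`. -/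
def clusterHull (G : SimpleGraph V) [G.LocallyFinite] (X S : Finset V) : Finset V :=
  vertexClosure G S ∪ X

omit [MeasurableSpace V] [DiscreteMeasurableSpace V] in
lemma mem_clusterHull {X S : Finset V} {x : V} :
    x ∈ clusterHull G X S ↔ x ∈ S ∨ (∃ y ∈ S, G.Adj y x) ∨ x ∈ X := by
  simp [clusterHull, vertexClosure]

omit [MeasurableSpace V] [DiscreteMeasurableSpace V] in
lemma levelCluster_eq_iff (X S : Finset V) (h : ℝ) (ω : Ω) :
    levelCluster G φ X h ω = S ↔ cluster G (S : Set V) X = S ∧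
      ω ∈ signEvent φ (clusterHull G X S) S h := by
  rw [levelCluster, cluster_eq_iff]
  refine and_congr_right fun _ => ?_
  simp only [signEvent, mem_clusterHull, Set.subset_def, Set.mem_ofPred_eq, Finset.mem_coe, not_le]
  constructor
  · rintro ⟨h1, h2, h3⟩ x hx
    refine ⟨h1 x, fun hxS => ?_⟩
    rcases hx with hx | ⟨y, hy, hyx⟩ | hx
    · exact absurd hx hxS
    · exact h3 y hy x hyx hxS
    · exact h2 x hx hxS
  · intro H
    exact ⟨fun x hx => (H x (.inl hx)).1 hx, fun x hx hxS => (H x (.inr (.inr hx))).2 hxS,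
      fun y hy x hyx hxS => (H x (.inr (.inl ⟨y, hy, hyx⟩))).2 hxS⟩

/-- The equilibrium measure of the hull charges no vertex of `S`, all of whose neighbours are in the
hull; on the rest of the hull the field is negative. -/
lemma equilibriumField_nonpos {X S : Finset V} {ω : Ω}
    (hω : ω ∈ signEvent φ (clusterHull G X S) S 0) :
    equilibriumField G φ (clusterHull G X S) ω ≤ 0 := by
  refine Finset.sum_nonpos fun x hx => ?_
  by_cases hxS : x ∈ S
  · have : eqMeasure G (clusterHull G X S) x = 0 := by
      rw [eqMeasure, escapeProb_eq_zero G (fun y hy => ?_) (by exact_mod_cast hx), mul_zero]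
      exact mem_clusterHull.2 (.inr (.inl ⟨x, hxS, hy⟩))
    rw [this, zero_mul]
  · exact mul_nonpos_of_nonneg_of_nonpos (eqMeasure_nonneg _ _) ((hω x hx).2 hxS).le

end Clusters

/-- A function that is constant on each member of a countable disjoint family and vanishes off it. -/
lemma integrable_of_piecewise_const {ι Ω : Type*} [Countable ι] [MeasurableSpace Ω]
    {P : Measure Ω} [IsFiniteMeasure P] {E : ι → Set Ω} (hE : ∀ i, NullMeasurableSet (E i) P)
    (hd : Pairwise (Function.onFun Disjoint E)) {a : ι → ℂ} {f : Ω → ℂ}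
    (hf : ∀ i, ∀ ω ∈ E i, f ω = a i) (hf0 : ∀ ω, (∀ i, ω ∉ E i) → f ω = 0)
    (hs : Summable fun i => ‖a i‖ * P.real (E i)) :
    Integrable f P ∧ ∫ ω, f ω ∂P = ∑' i, a i * P.real (E i) := by
  have hae : ∀ i, f =ᵐ[P.restrict (E i)] fun _ => a i := fun i =>
    (ae_restrict_mem₀ (hE i)).mono (hf i)
  have hon : ∀ i, IntegrableOn f (E i) P := fun i =>
    (integrable_const (a i)).congr (hae i).symm
  have hU : IntegrableOn f (⋃ i, E i) P := by
    refine integrableOn_iUnion_of_summable_integral_norm hon (hs.congr fun i => ?_)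
    rw [integral_congr_ae ((hae i).mono fun ω h => congrArg norm h)]
    simp [mul_comm]
  have hind : (⋃ i, E i).indicator f = f := by
    rw [Set.indicator_eq_self]
    intro ω hω
    by_contra hn
    exact hω (hf0 ω fun i hi => hn (Set.mem_iUnion.2 ⟨i, hi⟩))
  have hnull : NullMeasurableSet (⋃ i, E i) P := .iUnion hE
  refine ⟨by simpa only [hind] using hU.integrable_indicator₀ hnull, ?_⟩
  conv_lhs => rw [← hind]
  rw [integral_indicator₀ hnull, integral_iUnion_ae hE (fun i j hij => (hd hij).aedisjoint) hU]
  refine tsum_congr fun i => ?_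
  rw [integral_congr_ae (hae i)]
  simp [mul_comm]

/-! ### Holomorphic extension and uniform convergence of the cluster sum -/

section Observable

variable {V : Type*} [DecidableEq V] [MeasurableSpace V] [DiscreteMeasurableSpace V]
  {G : SimpleGraph V} [G.LocallyFinite]
  {Ω : Type*} [MeasurableSpace Ω] {P : Measure Ω} {φ : V → Ω → ℝ}

/-- The event that the union of the clusters meeting `X` at level `h` is `S`. -/
def clusterEvent (G : SimpleGraph V) (φ : V → Ω → ℝ) (X : Finset V) (h : ℝ) (S : Finset V) :
    Set Ω :=
  {ω | levelCluster G φ X h ω = S}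

omit [MeasurableSpace V] [DiscreteMeasurableSpace V] [MeasurableSpace Ω] in
lemma clusterEvent_eq_signEvent {X S : Finset V} (hS : cluster G (S : Set V) X = S) (h : ℝ) :
    clusterEvent G φ X h S = signEvent φ (clusterHull G X S) S h := by
  ext ω
  simp [clusterEvent, levelCluster_eq_iff, hS]

omit [MeasurableSpace V] [DiscreteMeasurableSpace V] [MeasurableSpace Ω] in
lemma clusterEvent_eq_empty {X S : Finset V} (hS : cluster G (S : Set V) X ≠ S) (h : ℝ) :
    clusterEvent G φ X h S = ∅ := by
  ext ω
  simp [clusterEvent, levelCluster_eq_iff, hS]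

lemma IsGFF.nullMeasurableSet_clusterEvent (hφ : IsGFF G P φ) (X S : Finset V) (h : ℝ) :
    NullMeasurableSet (clusterEvent G φ X h S) P := by
  by_cases hS : cluster G (S : Set V) X = S
  · rw [clusterEvent_eq_signEvent hS]
    exact hφ.nullMeasurableSet_signEvent _ _ _
  · rw [clusterEvent_eq_empty hS]
    exact .empty

omit [DecidableEq V] [MeasurableSpace V] [DiscreteMeasurableSpace V] [G.LocallyFinite]
  [MeasurableSpace Ω] in
lemma pairwise_disjoint_clusterEvent (X : Finset V) (h : ℝ) :
    Pairwise (Function.onFun Disjoint (clusterEvent G φ X h)) := by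
  intro S T hST
  rw [Function.onFun, Set.disjoint_left]
  intro ω h1 h2
  exact hST (Finset.coe_injective (h1.symm.trans h2))

omit [MeasurableSpace Ω] in
lemma clusterEvent_field_nonpos {X S : Finset V} {ω : Ω} (hω : ω ∈ clusterEvent G φ X 0 S) :
    equilibriumField G φ (clusterHull G X S) ω ≤ 0 :=
  equilibriumField_nonpos ((levelCluster_eq_iff X S 0 ω).1 hω).2

lemma IsGFF.summable_clusterEvent [Countable V] (hφ : IsGFF G P φ) (X : Finset V) (h : ℝ) :
    Summable fun S => P.real (clusterEvent G φ X h S) := by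
  have := hφ.gaussian.isProbabilityMeasure
  refine ENNReal.summable_toReal (ne_top_of_le_ne_top (measure_ne_top P Set.univ)
    (tsum_measure_le_measure_univ (fun S => hφ.nullMeasurableSet_clusterEvent X S h)
      fun S T hST => (pairwise_disjoint_clusterEvent X h hST).aedisjoint))

/-- The holomorphic extension in the level `z` of the probability that the cluster is `S`. -/
noncomputable def clusterProb (G : SimpleGraph V) [G.LocallyFinite] (P : Measure Ω)
    (φ : V → Ω → ℝ) (X S : Finset V) (z : ℂ) : ℂ :=
  Complex.exp (-(z ^ 2 * cap G (clusterHull G X S)) / 2) *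
    complexMGF (fun ω => -equilibriumField G φ (clusterHull G X S) ω)
      (P.restrict (clusterEvent G φ X 0 S)) z

lemma IsGFF.clusterProb_ofReal (hφ : IsGFF G P φ) (ht : IsTransient G) (X S : Finset V) (h : ℝ) :
    clusterProb G P φ X S h = P.real (clusterEvent G φ X h S) := by
  rw [clusterProb, complexMGF_ofReal]
  by_cases hS : cluster G (S : Set V) X = S
  · rw [clusterEvent_eq_signEvent hS, clusterEvent_eq_signEvent hS, hφ.real_signEvent ht, mgf]
    push_cast
    congr 3
    ext ω
    congr 1
    ring
  · rw [clusterEvent_eq_empty hS, clusterEvent_eq_empty hS]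
    simp

lemma IsGFF.integrable_exp_field (hφ : IsGFF G P φ) (X S : Finset V) {t : ℝ} (h : t ≤ 0) :
    Integrable (fun ω => Real.exp (t * -equilibriumField G φ (clusterHull G X S) ω))
      (P.restrict (clusterEvent G φ X 0 S)) := by
  have := hφ.gaussian.isProbabilityMeasure
  refine Integrable.of_bound ?_ 1 ?_
  · exact ((hφ.aemeasurable_equilibriumField _).neg.const_mul t).exp.restrict.aestronglyMeasurable
  · filter_upwards [ae_restrict_mem₀ (hφ.nullMeasurableSet_clusterEvent X S 0)] with ω hω
    rw [Real.norm_eq_abs, Real.abs_exp, Real.exp_le_one_iff]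
    exact mul_nonpos_of_nonpos_of_nonneg h (neg_nonneg.2 (clusterEvent_field_nonpos hω))

lemma IsGFF.differentiableOn_clusterProb (hφ : IsGFF G P φ) (X S : Finset V) :
    DifferentiableOn ℂ (clusterProb G P φ X S) {z | z.re < 0} := by
  refine DifferentiableOn.mul (by fun_prop) (differentiableOn_complexMGF.mono fun z hz => ?_)
  -- `complexMGF` is holomorphic over the interior of the integrability set, here at least the open
  -- left half-line.
  have : Set.Iic (0 : ℝ) ⊆ integrableExpSet
      (fun ω => -equilibriumField G φ (clusterHull G X S) ω)
      (P.restrict (clusterEvent G φ X 0 S)) := fun t ht => hφ.integrable_exp_field X S ht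
  exact interior_mono this (by simpa using hz)

/-- For Re z < 0 the exponential integrand has modulus at most 1 on the event, so only the Gaussian
prefactor and the probability at level 0 remain. -/
lemma IsGFF.norm_clusterProb_le (hφ : IsGFF G P φ) (X S : Finset V) {z : ℂ} (hz : z.re < 0) :
    ‖clusterProb G P φ X S z‖ ≤
      Real.exp (-((z ^ 2).re * cap G (clusterHull G X S)) / 2) *
        P.real (clusterEvent G φ X 0 S) := by
  have := hφ.gaussian.isProbabilityMeasure
  rw [clusterProb, norm_mul, Complex.norm_exp]
  refine mul_le_mul (le_of_eq ?_) (norm_complexMGF_le_mgf.trans ?_) (norm_nonneg _)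
    (Real.exp_pos _).le
  · congr 1
    rw [show -(z ^ 2 * (cap G (clusterHull G X S) : ℂ)) / 2 =
      z ^ 2 * ((-cap G (clusterHull G X S) / 2 : ℝ) : ℂ) by push_cast; ring, Complex.re_mul_ofReal]
    ring
  · calc mgf _ (P.restrict (clusterEvent G φ X 0 S)) z.re
        ≤ ∫ _, (1 : ℝ) ∂P.restrict (clusterEvent G φ X 0 S) := by
          refine integral_mono_ae (hφ.integrable_exp_field X S hz.le) (integrable_const _) ?_
          filter_upwards [ae_restrict_mem₀ (hφ.nullMeasurableSet_clusterEvent X S 0)] with ω hω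
          rw [Real.exp_le_one_iff]
          exact mul_nonpos_of_nonpos_of_nonneg hz.le (neg_nonneg.2 (clusterEvent_field_nonpos hω))
      _ = P.real (clusterEvent G φ X 0 S) := by simp

/-- For large cap(S̄) use the growth bound with rate `δ` and monotonicity of capacity, as the hull
contains S̄; for small cap(S̄) use local boundedness, which is where `S` must be a possible cluster.
-/
lemma SubexponentialGrowth.exists_bound {F : Finset V → ℂ} (hF : SubexponentialGrowth G F)
    (ht : IsTransient G) (hsymm : ∀ x y, green G x y = green G y x) (X : Finset V)
    {δ : ℝ} (hδ : 0 < δ) : ∃ B : ℝ, ∀ S : Finset V, cluster G (S : Set V) X = S →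
      ‖F S‖ * Real.exp (-(δ * cap G (clusterHull G X S))) ≤ B := by
  obtain ⟨R, hR⟩ := hF.growth δ hδ
  obtain ⟨C, hC⟩ := hF.locally_bounded X R
  refine ⟨max 1 C, fun S hS => ?_⟩
  have hmono : cap G (vertexClosure G S) ≤ cap G (clusterHull G X S) :=
    ht.cap_mono hsymm Finset.subset_union_left
  by_cases hle : R ≤ cap G (vertexClosure G S)
  · refine le_trans ?_ (le_max_left _ _)
    calc ‖F S‖ * Real.exp (-(δ * cap G (clusterHull G X S)))
        ≤ Real.exp (δ * cap G (vertexClosure G S)) *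
          Real.exp (-(δ * cap G (clusterHull G X S))) := by
          gcongr
          exact hR S hle
      _ ≤ 1 := by
          rw [← Real.exp_add, Real.exp_le_one_iff]
          nlinarith
  · refine le_trans ?_ (le_max_right _ _)
    calc ‖F S‖ * Real.exp (-(δ * cap G (clusterHull G X S))) ≤ ‖F S‖ * 1 := by
          gcongr
          rw [Real.exp_le_one_iff]
          exact neg_nonpos.2 (mul_nonneg hδ.le (cap_nonneg _))
      _ ≤ C := by
          rw [mul_one]
          exact hC S hS (not_le.1 hle).le

/-- The part of the cone `Re z < 0 < Re z²` where cluster sums converge uniformly. -/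
def leftCone (δ : ℝ) : Set ℂ := {z | z.re < 0 ∧ 2 * δ < (z ^ 2).re}

lemma isOpen_leftCone (δ : ℝ) : IsOpen (leftCone δ) :=
  (isOpen_lt Complex.continuous_re continuous_const).inter
    (isOpen_lt continuous_const (Complex.continuous_re.comp (continuous_pow 2)))

/-- With δ = h² / 4 the cone requires Re z² > h² / 2, which leaves room around `h`. -/
lemma ofReal_mem_leftCone {h : ℝ} (hh : h < 0) : (h : ℂ) ∈ leftCone (h ^ 2 / 4) := by
  refine ⟨by simpa using hh, ?_⟩
  rw [← Complex.ofReal_pow, Complex.ofReal_re]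
  nlinarith [pow_pos (neg_pos.2 hh) 2]

lemma IsGFF.exists_norm_mul_clusterProb_le (hφ : IsGFF G P φ) (ht : IsTransient G)
    {F : Finset V → ℂ} (hF : SubexponentialGrowth G F) (X : Finset V) {δ : ℝ} (hδ : 0 < δ) :
    ∃ B : ℝ, ∀ S : Finset V, ∀ z ∈ leftCone δ,
      ‖F S * clusterProb G P φ X S z‖ ≤ B * P.real (clusterEvent G φ X 0 S) := by
  obtain ⟨B, hB⟩ := hF.exists_bound ht hφ.green_symm X hδ
  refine ⟨B, fun S z hz => ?_⟩
  have hle := hφ.norm_clusterProb_le X S hz.1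
  by_cases hS : cluster G (S : Set V) X = S
  · rw [norm_mul]
    calc ‖F S‖ * ‖clusterProb G P φ X S z‖
        ≤ ‖F S‖ * (Real.exp (-(δ * cap G (clusterHull G X S))) *
          P.real (clusterEvent G φ X 0 S)) := by
          refine mul_le_mul_of_nonneg_left (hle.trans ?_) (norm_nonneg _)
          gcongr
          nlinarith [cap_nonneg (G := G) (clusterHull G X S), hz.2]
      _ ≤ B * P.real (clusterEvent G φ X 0 S) := by
          rw [← mul_assoc]
          exact mul_le_mul_of_nonneg_right (hB S hS) measureReal_nonneg
  -- Here `F S` need not be controlled, but an impossible cluster has probability zero.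
  · rw [clusterEvent_eq_empty hS] at hle ⊢
    have h0 : clusterProb G P φ X S z = 0 := by simpa using hle
    simp [h0]

lemma IsGFF.integrable_truncatedObservable [Countable V] (hφ : IsGFF G P φ) (ht : IsTransient G)
    {F : Finset V → ℂ} (hF : SubexponentialGrowth G F) (X : Finset V) {h : ℝ} (hh : h < 0) :
    Integrable (truncatedObservable G φ F X h) P ∧
      meanObservable G P φ F X h = ∑' S, F S * clusterProb G P φ X S h := by
  have := hφ.gaussian.isProbabilityMeasure
  simp_rw [hφ.clusterProb_ofReal ht]
  refine integrable_of_piecewise_const (fun S => hφ.nullMeasurableSet_clusterEvent X S h)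
    (pairwise_disjoint_clusterEvent X h) ?_ ?_ ?_
  · intro S ω hω
    have hω' : levelCluster G φ X h ω = S := hω
    have hfin : (levelCluster G φ X h ω).Finite := hω' ▸ S.finite_toSet
    rw [truncatedObservable, dif_pos hfin]
    congr 1
    apply Finset.coe_injective
    rw [hfin.coe_toFinset, hω']
  · intro ω hω
    rw [truncatedObservable, dif_neg]
    intro hfin
    exact hω hfin.toFinset hfin.coe_toFinset.symm
  · obtain ⟨B, hB⟩ := hφ.exists_norm_mul_clusterProb_le ht hF X
      (by nlinarith [pow_pos (neg_pos.2 hh) 2] : 0 < h ^ 2 / 4)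
    -- The terms at level `h` are dominated by the probabilities of the disjoint events at level 0.
    refine Summable.of_nonneg_of_le (fun S => by positivity) (fun S => ?_)
      ((hφ.summable_clusterEvent X 0).mul_left B)
    have := hB S h (ofReal_mem_leftCone hh)
    rw [hφ.clusterProb_ofReal ht, norm_mul, Complex.norm_real, Real.norm_of_nonneg
      measureReal_nonneg] at this
    exact this

lemma IsGFF.differentiableOn_tsum_clusterProb [Countable V] (hφ : IsGFF G P φ)
    (ht : IsTransient G) {F : Finset V → ℂ} (hF : SubexponentialGrowth G F) (X : Finset V)
    {δ : ℝ} (hδ : 0 < δ) :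
    DifferentiableOn ℂ (fun z => ∑' S, F S * clusterProb G P φ X S z) (leftCone δ) := by
  obtain ⟨B, hB⟩ := hφ.exists_norm_mul_clusterProb_le ht hF X hδ
  refine Complex.differentiableOn_tsum_of_summable_norm
    ((hφ.summable_clusterEvent X 0).mul_left B) (fun S => ?_) (isOpen_leftCone δ)
    fun S z hz => hB S z hz
  exact ((hφ.differentiableOn_clusterProb X S).mono fun z hz => hz.1).const_mul _

end Observable

end GFFPercolation

theorem theorem1p5 {V : Type*} [DecidableEq V] [MeasurableSpace V] [DiscreteMeasurableSpace V]
    (G : SimpleGraph V) [G.LocallyFinite] (hconn : G.Connected)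
    (htrans : GFFPercolation.IsTransient G)
    {Ω : Type*} [MeasurableSpace Ω] (P : MeasureTheory.Measure Ω)
    [MeasureTheory.IsProbabilityMeasure P]
    (φ : V → Ω → ℝ) (hφ : GFFPercolation.IsGFF G P φ)
    (F : Finset V → ℂ) (hF : GFFPercolation.SubexponentialGrowth G F) (X : Finset V) :
    (∀ h : ℝ, h < 0 →
      MeasureTheory.Integrable (GFFPercolation.truncatedObservable G φ F X h) P) ∧
    AnalyticOnNhd ℝ (fun h : ℝ => GFFPercolation.meanObservable G P φ F X h)
      (Set.Iio (0 : ℝ)) := by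
  have := GFFPercolation.countable_of_connected hconn
  refine ⟨fun h hh => (hφ.integrable_truncatedObservable htrans hF X hh).1, fun h hh => ?_⟩
  have hh' : h < 0 := hh
  have hδ : 0 < h ^ 2 / 4 := by nlinarith [pow_pos (neg_pos.2 hh') 2]
  have hC := (hφ.differentiableOn_tsum_clusterProb htrans hF X hδ).analyticAt
    ((GFFPercolation.isOpen_leftCone _).mem_nhds (GFFPercolation.ofReal_mem_leftCone hh'))
  have hR := AnalyticAt.comp (f := fun t : ℝ => (t : ℂ)) hC.restrictScalars
    (Complex.ofRealCLM.analyticAt h)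
  -- The series represents the mean observable only at negative levels, which suffices near `h`.
  refine hR.congr ?_
  filter_upwards [Iio_mem_nhds hh'] with t ht
  exact (hφ.integrable_truncatedObservable htrans hF X ht).2.symm
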